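/- Let $B^H=(B^H_t)_{t\ge 0}$ be a standard fractional Brownian motion with Hurst parameter $H\in(0,1]$, that is, a centred Gaussian process with almost surely continuous paths and $\mathrm{Cov}(B^H_s,B^H_t)=\tfrac12\big(s^{2H}+t^{2H}-|s-t|^{2H}\big)$ for $s,t\ge 0$. Let $\delta>0$ and $T\in(0,\infty)$. Define the $\delta$-fluctuation times $(\tau_j)_{j\ge0}$ of $B^H$, with values in $[0,\infty]$, by $\tau_0=0$ and $$\tau_{j+1}=\inf\{t\ge\tau_j : |B^H_t-B^H_{\tau_j}|\ge\delta\},\qquad \inf\emptyset=\infty,$$ and the number of $\delta$-fluctuations up to time $T$ by $F^{(\delta)}_T=\sup\{j\ge0 : \tau_j\le T\}$. Then $F^{(\delta)}_T$ is a random variable (measurable up to a null set) that has exponential moments of all orders, that is, $$E\big[\exp\big(aF^{(\delta)}_T\big)\big]<\infty\quad\text{for all }a\in\mathbb R.$$ Moreover, if $H\ge 1/2$, then it has a Gaussian moment, that is, there exists $a>0$ such that $$E\big[\exp\big(a\,(F^{(\delta)}_T)^2\big)\big]<\infty.$$ -/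

import Mathlib

open MeasureTheory ProbabilityTheory
open scoped NNReal ENNReal

/-- `B = (B t)_{t ≥ 0}` is a standard fractional Brownian motion with Hurst parameter `H` under `P`:
a centred Gaussian process with covariance `(s ^ (2H) + t ^ (2H) - |s - t| ^ (2H)) / 2` and almost
surely continuous paths. -/
structure IsFractionalBrownianMotion {Ω : Type*} [MeasurableSpace Ω] (H : ℝ)
    (B : ℝ≥0 → Ω → ℝ) (P : Measure Ω) : Prop where
  isGaussianProcess : IsGaussianProcess B P
  integral_eq_zero : ∀ t, ∫ ω, B t ω ∂P = 0
  covariance_eq : ∀ s t : ℝ≥0,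
    cov[B s, B t; P] =
      ((s : ℝ) ^ (2 * H) + (t : ℝ) ^ (2 * H) - |(s : ℝ) - (t : ℝ)| ^ (2 * H)) / 2
  continuous_paths : ∀ᵐ ω ∂P, Continuous fun t ↦ B t ω

/-- The `δ`-fluctuation times of a path `x : [0, ∞) → ℝ`, with values in `[0, ∞]`:
`τ 0 = 0` and `τ (j + 1) = inf {t ≥ τ j | |x t - x (τ j)| ≥ δ}`, where `inf ∅ = ∞`.
(If `τ j = ∞` then no real `t` satisfies `t ≥ τ j`, so that `τ (j + 1) = ∞`.) -/
noncomputable def fluctuationTime (δ : ℝ) (x : ℝ≥0 → ℝ) : ℕ → ℝ≥0∞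
  | 0 => 0
  | j + 1 => sInf ((fun t : ℝ≥0 ↦ (t : ℝ≥0∞)) ''
      {t : ℝ≥0 | fluctuationTime δ x j ≤ t ∧
        δ ≤ |x t - x (fluctuationTime δ x j).toNNReal|})

/-- The number `sup {j ≥ 0 | τ j ≤ T}` of `δ`-fluctuations of the path `x` up to time `T`,
with values in `{0, 1, 2, …, ∞}`. -/
noncomputable def fluctuationNumber (δ : ℝ) (T : ℝ≥0) (x : ℝ≥0 → ℝ) : ℕ∞ :=
  sSup ((fun j : ℕ ↦ (j : ℕ∞)) '' {j : ℕ | fluctuationTime δ x j ≤ T})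

/-! If `n` fluctuations occur by time `T`, continuity gives a chain of times in `[0, T]` whose `n`
increments all have size at least `δ`. At the cost of replacing `δ` by `δ / 2` and `T` by `T + 1`,
the chain can be taken in a countable dense set. All but `⌈(T + 1) / η⌉` of its steps have length at
most `η`. Keeping `m` short steps and weighting them by the signs of their increments gives a signed
sum that exceeds `m δ / 2`.

All such signed sums, over all chains and signs, form a countable centred Gaussian family. If the
path oscillates by at most `δ / 4` over times at distance `η`, an event of probability at least `1 /
2` for small `η`, every one of these sums is at most `m δ / 4`. Gaussian concentration for the
supremum (`measure_exists_ge_mul_measure_forall_le`) then bounds the probability that some sum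
reaches `m δ / 2` by `2 exp (-2 (m δ / 4)² / (π² σ²))`, where `σ²` bounds the variances
(`measure_le_fluctuationNumber_le`).

It remains to bound the variances. For `H ≥ 1 / 2` increments are positively correlated, so `σ² = (T
+ 1) ^ (2H)` works for every `m` and the tail is Gaussian. For `H ≤ 1 / 2` they are negatively
correlated and `σ² = 2 m η ^ (2H)` works: the tail is exponential in `m`, with a rate that becomes
arbitrarily large as `η → 0`. -/

/-! ### Fluctuation times of a continuous path. -/

section Paths

variable {δ : ℝ} {x : ℝ≥0 → ℝ}

lemma fluctuationTime_le_succ (δ : ℝ) (x : ℝ≥0 → ℝ) (j : ℕ) :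
    fluctuationTime δ x j ≤ fluctuationTime δ x (j + 1) := by
  rw [fluctuationTime]
  refine le_sInf ?_
  rintro _ ⟨t, ht, rfl⟩
  exact ht.1

lemma fluctuationTime_mono (δ : ℝ) (x : ℝ≥0 → ℝ) : Monotone (fluctuationTime δ x) :=
  monotone_nat_of_le_succ (fluctuationTime_le_succ δ x)

/-- For a continuous path, the infimum that defines the next fluctuation time is attained. -/
lemma exists_fluctuationTime_succ_eq (hx : Continuous x) {j : ℕ}
    (h : fluctuationTime δ x (j + 1) ≠ ∞) :
    ∃ t : ℝ≥0, fluctuationTime δ x (j + 1) = t ∧ fluctuationTime δ x j ≤ t ∧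
      δ ≤ |x t - x (fluctuationTime δ x j).toNNReal| := by
  set S : Set ℝ≥0 := {t : ℝ≥0 | fluctuationTime δ x j ≤ t ∧
    δ ≤ |x t - x (fluctuationTime δ x j).toNNReal|} with hS
  have hdef : fluctuationTime δ x (j + 1) = sInf ((fun t : ℝ≥0 ↦ (t : ℝ≥0∞)) '' S) := rfl
  have hne : S.Nonempty := by
    by_contra hcon
    rw [Set.not_nonempty_iff_eq_empty] at hcon
    exact h (by rw [hdef, hcon, Set.image_empty, sInf_empty])
  have hcl : IsClosed S :=
    (isClosed_le continuous_const ENNReal.continuous_coe).inter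
      (isClosed_le continuous_const (hx.sub continuous_const).abs)
  have hmem := hcl.csInf_mem hne (OrderBot.bddBelow S)
  refine ⟨sInf S, ?_, hmem.1, hmem.2⟩
  rw [hdef, ENNReal.coe_sInf hne, sInf_image]

lemma fluctuationTime_succ_le_iff (hx : Continuous x) {j : ℕ} {c : ℝ≥0} :
    fluctuationTime δ x (j + 1) ≤ c ↔ fluctuationTime δ x j ≤ c ∧
      ∃ t : ℝ≥0, fluctuationTime δ x j ≤ t ∧ t ≤ c ∧
        δ ≤ |x t - x (fluctuationTime δ x j).toNNReal| := by
  constructor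
  · intro h
    refine ⟨(fluctuationTime_le_succ δ x j).trans h, ?_⟩
    obtain ⟨t, ht, h1, h2⟩ :=
      exists_fluctuationTime_succ_eq hx (ne_top_of_le_ne_top ENNReal.coe_ne_top h)
    exact ⟨t, h1, by rw [ht] at h; exact_mod_cast h, h2⟩
  · rintro ⟨-, t, h1, h2, h3⟩
    rw [fluctuationTime]
    exact sInf_le_of_le ⟨t, ⟨h1, h3⟩, rfl⟩ (ENNReal.coe_le_coe.2 h2)

/-- The fluctuation times increase, so the indices `j` with `τ j ≤ T` form an initial segment of
`ℕ`. -/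
lemma natCast_le_fluctuationNumber_iff {T : ℝ≥0} {n : ℕ} :
    (n : ℕ∞) ≤ fluctuationNumber δ T x ↔ fluctuationTime δ x n ≤ T := by
  constructor
  · intro h
    by_contra hcon
    cases n with
    | zero => exact hcon (by simp [fluctuationTime])
    | succ n =>
      have : fluctuationNumber δ T x ≤ n := by
        refine sSup_le ?_
        rintro _ ⟨j, hj, rfl⟩
        have : j < n + 1 := by
          by_contra hj'
          exact hcon ((fluctuationTime_mono δ x (not_lt.1 hj')).trans hj)
        simpa using Nat.lt_succ_iff.1 this
      have := h.trans this
      norm_cast at this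
      omega
  · exact fun h ↦ le_sSup ⟨n, h, rfl⟩

/-- The fluctuations of a continuous path up to time `T`, as a chain of times. -/
lemma exists_strictMono_of_fluctuationTime_le (hx : Continuous x) (hδ : 0 < δ) {T : ℝ≥0} {n : ℕ}
    (h : fluctuationTime δ x n ≤ T) :
    ∃ s : Fin (n + 1) → ℝ≥0, StrictMono s ∧ (∀ i, s i ≤ T) ∧
      ∀ i : Fin n, δ ≤ |x (s i.succ) - x (s i.castSucc)| := by
  have hle (i : Fin (n + 1)) : fluctuationTime δ x i ≤ T :=
    (fluctuationTime_mono δ x (Nat.lt_succ_iff.1 i.2)).trans h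
  have hstep (i : Fin n) : δ ≤ |x (fluctuationTime δ x (i + 1)).toNNReal
      - x (fluctuationTime δ x i).toNNReal| := by
    obtain ⟨t, ht, -, h2⟩ := exists_fluctuationTime_succ_eq hx
      (ne_top_of_le_ne_top ENNReal.coe_ne_top (hle i.succ))
    rw [show fluctuationTime δ x (i + 1) = t from ht, ENNReal.toNNReal_coe]
    exact h2
  refine ⟨fun i ↦ (fluctuationTime δ x i).toNNReal, Fin.strictMono_iff_lt_succ.2 fun i ↦ ?_,
    fun i ↦ by simpa using ENNReal.toNNReal_mono ENNReal.coe_ne_top (hle i), hstep⟩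
  refine lt_of_le_of_ne (ENNReal.toNNReal_mono (ne_top_of_le_ne_top ENNReal.coe_ne_top
    (hle i.succ)) (fluctuationTime_le_succ δ x i)) fun heq ↦ ?_
  have := hstep i
  simp only [Fin.val_castSucc, Fin.val_succ] at heq
  rw [heq, sub_self, abs_zero] at this
  exact hδ.not_ge this

end Paths

/-! ### Measurability of the fluctuation number. -/

section Measurability

variable {Ω : Type*} [MeasurableSpace Ω] {X : ℝ≥0 → Ω → ℝ}

/-- A continuous function reaches a level on `[u, c]` iff it comes arbitrarily close to it on a
fixed countable set of convex combinations of `u` and `c`. -/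
lemma exists_mem_Icc_le_iff {f : ℝ≥0 → ℝ} (hf : Continuous f) {δ : ℝ} {u c : ℝ≥0} (huc : u ≤ c) :
    (∃ t, u ≤ t ∧ t ≤ c ∧ δ ≤ f t) ↔
      ∀ k : ℕ, ∃ m : ℕ, δ - 1 / ((k : ℝ) + 1) <
        f (u + min (TopologicalSpace.denseSeq ℝ≥0 m) 1 * (c - u)) := by
  set g : ℝ≥0 → ℝ := fun q ↦ f (u + min q 1 * (c - u)) with hg
  have hgc : Continuous g := by fun_prop
  constructor
  · rintro ⟨t, hut, htc, ht⟩ k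
    have hopen : IsOpen {q | δ - 1 / ((k : ℝ) + 1) < g q} := isOpen_lt continuous_const hgc
    have hne : {q | δ - 1 / ((k : ℝ) + 1) < g q}.Nonempty := by
      have hk : (0 : ℝ) < 1 / ((k : ℝ) + 1) := by positivity
      rcases huc.eq_or_lt with rfl | hlt
      · obtain rfl := le_antisymm htc hut
        refine ⟨0, ?_⟩
        simp only [Set.mem_ofPred_eq, hg, tsub_self, mul_zero, add_zero]
        linarith
      · have hcu : c - u ≠ 0 := (tsub_pos_of_lt hlt).ne'
        refine ⟨(t - u) / (c - u), ?_⟩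
        have h1 : (t - u) / (c - u) ≤ 1 := div_le_one_of_le₀ (tsub_le_tsub_right htc u) zero_le
        simp only [Set.mem_ofPred_eq, hg]
        rw [min_eq_left h1, div_mul_cancel₀ _ hcu, add_tsub_cancel_of_le hut]
        linarith
    obtain ⟨m, hm⟩ := (TopologicalSpace.denseRange_denseSeq ℝ≥0).exists_mem_open hopen hne
    exact ⟨m, hm⟩
  · intro h
    obtain ⟨t, ht, hmax⟩ := isCompact_Icc.exists_isMaxOn (Set.nonempty_Icc.2 huc) hf.continuousOn
    refine ⟨t, ht.1, ht.2, le_of_forall_pos_lt_add fun ε hε ↦ ?_⟩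
    obtain ⟨k, hk⟩ := exists_nat_one_div_lt hε
    obtain ⟨m, hm⟩ := h k
    have hmem : u + min (TopologicalSpace.denseSeq ℝ≥0 m) 1 * (c - u) ∈ Set.Icc u c := by
      refine ⟨le_self_add, ?_⟩
      calc _ ≤ u + 1 * (c - u) := by gcongr; exact min_le_right _ _
        _ = c := by rw [one_mul, add_tsub_cancel_of_le huc]
    have := hmax hmem
    simp only [Set.mem_ofPred_eq] at this
    linarith

lemma measurable_fluctuationTime (hX : ∀ t, Measurable (X t))
    (hc : ∀ ω, Continuous fun t ↦ X t ω) (δ : ℝ) (j : ℕ) :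
    Measurable fun ω ↦ fluctuationTime δ (fun t ↦ X t ω) j := by
  have huncurry : Measurable (Function.uncurry X) :=
    measurable_uncurry_of_continuous_of_measurable hc hX
  have hcomp {g : Ω → ℝ≥0} (hg : Measurable g) : Measurable fun ω ↦ X (g ω) ω :=
    huncurry.comp (hg.prodMk measurable_id)
  induction j with
  | zero => exact measurable_const
  | succ j ih =>
    have hu := ih.ennreal_toNNReal
    have hset (c : ℝ≥0) : MeasurableSet {ω | fluctuationTime δ (fun t ↦ X t ω) (j + 1) ≤ c} := by
      have : {ω | fluctuationTime δ (fun t ↦ X t ω) (j + 1) ≤ c} =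
          {ω | fluctuationTime δ (fun t ↦ X t ω) j ≤ c} ∩
          ⋂ k : ℕ, ⋃ m : ℕ, {ω | δ - 1 / ((k : ℝ) + 1) <
            |X ((fluctuationTime δ (fun t ↦ X t ω) j).toNNReal
              + min (TopologicalSpace.denseSeq ℝ≥0 m) 1 *
                (c - (fluctuationTime δ (fun t ↦ X t ω) j).toNNReal)) ω
              - X (fluctuationTime δ (fun t ↦ X t ω) j).toNNReal ω|} := by
        ext ω
        simp only [Set.mem_ofPred_eq, Set.mem_inter_iff, Set.mem_iInter, Set.mem_iUnion,
          fluctuationTime_succ_le_iff (hc ω)]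
        -- On `τ j ≤ c` the time `τ j` is finite, so the value `0` of `toNNReal` at `∞` plays no
        -- role.
        refine and_congr_right fun hle ↦ ?_
        have htop := ne_top_of_le_ne_top ENNReal.coe_ne_top hle
        obtain ⟨u, hu⟩ : ∃ u : ℝ≥0, (u : ℝ≥0∞) = fluctuationTime δ (fun t ↦ X t ω) j :=
          ⟨_, ENNReal.coe_toNNReal htop⟩
        rw [← hu] at hle ⊢
        simp only [ENNReal.toNNReal_coe, ENNReal.coe_le_coe] at hle ⊢
        exact exists_mem_Icc_le_iff (f := fun t ↦ |X t ω - X u ω|)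
          (((hc ω).sub continuous_const).abs) hle
      rw [this]
      refine (measurableSet_le ih measurable_const).inter (.iInter fun k ↦ .iUnion fun m ↦ ?_)
      refine measurableSet_lt measurable_const (Measurable.abs ?_)
      exact (hcomp (hu.add ((measurable_const.sub hu).const_mul _))).sub (hcomp hu)
    refine measurable_of_Iic fun c ↦ ?_
    induction c with
    | top => simp
    | coe c => exact hset c

lemma measurable_fluctuationNumber (hX : ∀ t, Measurable (X t))
    (hc : ∀ ω, Continuous fun t ↦ X t ω) (δ : ℝ) (T : ℝ≥0) :
    Measurable fun ω ↦ fluctuationNumber δ T fun t ↦ X t ω := by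
  have hset (n : ℕ) : MeasurableSet {ω | (n : ℕ∞) ≤ fluctuationNumber δ T fun t ↦ X t ω} := by
    simp only [natCast_le_fluctuationNumber_iff]
    exact measurableSet_le (measurable_fluctuationTime hX hc δ n) measurable_const
  refine ENat.measurable_iff.2 fun n ↦ ?_
  convert (hset n).diff (hset (n + 1)) using 1
  ext ω
  simp only [Set.mem_preimage, Set.mem_singleton_iff, Set.mem_sdiff, Set.mem_ofPred_eq, not_le,
    Nat.cast_add, Nat.cast_one, ENat.lt_add_one_iff (ENat.natCast_ne_top n)]
  rw [and_comm, ← le_antisymm_iff]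

/-- A process with almost surely continuous paths has a modification with continuous paths. -/
lemma exists_measurable_continuous_modification {P : Measure Ω} {B : ℝ≥0 → Ω → ℝ}
    (hB : ∀ t, AEMeasurable (B t) P) (hc : ∀ᵐ ω ∂P, Continuous fun t ↦ B t ω) :
    ∃ X : ℝ≥0 → Ω → ℝ, (∀ t, Measurable (X t)) ∧ (∀ ω, Continuous fun t ↦ X t ω) ∧
      ∀ᵐ ω ∂P, ∀ t, B t ω = X t ω := by
  classical
  set q := TopologicalSpace.denseSeq ℝ≥0
  have hgood : ∀ᵐ ω ∂P, (Continuous fun t ↦ B t ω) ∧ ∀ m, B (q m) ω = (hB (q m)).mk _ ω :=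
    hc.and (ae_all_iff.2 fun m ↦ (hB (q m)).ae_eq_mk)
  obtain ⟨N, hN, hNm, hN0⟩ := exists_measurable_superset_of_null (ae_iff.1 hgood)
  have hgoodN (ω) (hω : ω ∉ N) :
      (Continuous fun t ↦ B t ω) ∧ ∀ m, B (q m) ω = (hB (q m)).mk _ ω := by
    by_contra hcon
    exact hω (hN hcon)
  have hcont (ω) : Continuous fun t ↦ Nᶜ.indicator (B t) ω := by
    by_cases hω : ω ∈ N
    · simpa [Set.indicator, hω] using continuous_const
    · simpa [Set.indicator, hω] using (hgoodN ω hω).1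
  refine ⟨fun t ↦ Nᶜ.indicator (B t), fun t ↦ ?_, hcont, ?_⟩
  -- Off the null set `N` the process equals its measurable versions at the countably many dense
  -- times; continuity extends measurability to all other times.
  · have hq (m : ℕ) : Measurable (Nᶜ.indicator (B (q m))) := by
      have : Nᶜ.indicator (B (q m)) = Nᶜ.indicator ((hB (q m)).mk _) :=
        Set.indicator_congr fun ω hω ↦ (hgoodN ω hω).2 m
      rw [this]
      exact (hB (q m)).measurable_mk.indicator hNm.compl
    obtain ⟨u, hu, hlim⟩ := mem_closure_iff_seq_limit.1
      (TopologicalSpace.denseRange_denseSeq ℝ≥0 t)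
    refine measurable_of_tendsto_metrizable (f := fun k ↦ Nᶜ.indicator (B (u k))) (fun k ↦ ?_)
      (tendsto_pi_nhds.2 fun ω ↦ ((hcont ω).tendsto t).comp hlim)
    obtain ⟨m, hm⟩ := hu k
    rw [← hm]
    exact hq m
  · filter_upwards [compl_mem_ae_iff.2 hN0] with ω hω t
    simp [Set.indicator_of_mem hω]

end Measurability

/-! ### Gaussian concentration for suprema, by the Maurey-Pisier rotation. -/

section Concentration

variable {K : Type*}

/-- A finite family of coordinates admits a measurable choice of a maximal one. -/
lemma exists_measurable_argmax (K : Type*) [Finite K] [Nonempty K] [MeasurableSpace K]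
    [MeasurableSingletonClass K] :
    ∃ κ : (K → ℝ) → K, Measurable κ ∧ ∀ (u : K → ℝ) (l : K), u l ≤ u (κ u) := by
  classical
  obtain ⟨n, ⟨e⟩⟩ := Finite.exists_equiv_fin K
  -- Ties are broken by the smallest index in an enumeration of `K`, which keeps the choice
  -- measurable.
  have hex (u : K → ℝ) : ∃ N : ℕ, ∃ h : N < n, ∀ l, u l ≤ u (e.symm ⟨N, h⟩) := by
    obtain ⟨k, hk⟩ := Finite.exists_max u
    exact ⟨e k, (e k).2, by simpa using hk⟩
  have hlt (u : K → ℝ) : Nat.find (hex u) < n := (Nat.find_spec (hex u)).1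
  have hmeas : Measurable fun u ↦ Nat.find (hex u) := by
    refine measurable_find hex fun N ↦ ?_
    by_cases h : N < n
    · simp only [h, exists_true_left]
      rw [Set.ofPred_forall]
      exact .iInter fun l ↦ measurableSet_le (measurable_pi_apply _) (measurable_pi_apply _)
    · simp [h]
  refine ⟨fun u ↦ e.symm ⟨Nat.find (hex u), hlt u⟩, ?_, fun u l ↦ (Nat.find_spec (hex u)).2 l⟩
  have : Measurable fun u ↦ (⟨Nat.find (hex u), hlt u⟩ : Fin n) := by
    refine measurable_to_countable' fun i ↦ ?_
    convert hmeas (measurableSet_singleton (i : ℕ)) using 1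
    ext u
    simp [Fin.ext_iff]
  exact (measurable_of_countable e.symm).comp this

lemma lintegral_exp_mul_eval_le [Fintype K] {μ : Measure (K → ℝ)} [IsGaussian μ] {σ : ℝ} (k : K)
    (hμ : ∫ u, u k ∂μ = 0) (hσ : Var[fun u ↦ u k; μ] ≤ σ ^ 2) (c : ℝ) :
    ∫⁻ u, ENNReal.ofReal (Real.exp (c * u k)) ∂μ
      ≤ ENNReal.ofReal (Real.exp (σ ^ 2 * c ^ 2 / 2)) := by
  have hG : HasGaussianLaw (fun u : K → ℝ ↦ u k) μ :=
    (IsGaussian.hasGaussianLaw_id (μ := μ)).eval k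
  have h := mgf_gaussianReal hG.map_eq_gaussianReal c
  -- Without integrability the `mgf` would take the default value `0`, but the Gaussian formula
  -- makes it positive.
  have hint : Integrable (fun u : K → ℝ ↦ Real.exp (c * u k)) μ := by
    by_contra hcon
    rw [mgf, integral_undef hcon] at h
    exact (Real.exp_pos _).ne h
  rw [← ofReal_integral_eq_lintegral_ofReal hint (.of_forall fun _ ↦ (Real.exp_pos _).le)]
  refine ENNReal.ofReal_le_ofReal ?_
  rw [mgf] at h
  rw [h, hμ]
  simp only [zero_mul, zero_add, Real.coe_toNNReal _ (variance_nonneg _ _)]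
  gcongr

/-- Maurey-Pisier bound for the difference of two independent copies of the maximum of a centred
Gaussian vector, with the error term of a discretisation of the rotation into `M` steps. -/
lemma lintegral_exp_max_sub_max_le_aux [Fintype K] [Nonempty K] [MeasurableSpace K]
    [MeasurableSingletonClass K] {μ : Measure (K → ℝ)} [IsGaussian μ] {σ : ℝ}
    (hμ : ∀ k, ∫ u, u k ∂μ = 0) (hσ : ∀ k, Var[fun u ↦ u k; μ] ≤ σ ^ 2)
    {κ : (K → ℝ) → K} (hκ : Measurable κ) (hmax : ∀ (u : K → ℝ) (l : K), u l ≤ u (κ u))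
    {c : ℝ} (hc : 0 ≤ c) {M : ℕ} (hM : 0 < M) (hcM : c * Real.pi ^ 2 / (8 * M) ≤ 1) :
    ∫⁻ p, ENNReal.ofReal (Real.exp (c * (p.2 (κ p.2) - p.1 (κ p.1)))) ∂(μ.prod μ)
      ≤ ENNReal.ofReal (Real.exp (σ ^ 2 * (c * (Real.pi / 2)) ^ 2 / 2)) *
        (1 + ENNReal.ofReal (c * Real.pi ^ 2 / (8 * M)) *
          (Fintype.card K * ENNReal.ofReal (Real.exp (σ ^ 2 / 2)))) := by
  have hM' : (0 : ℝ) < M := by exact_mod_cast hM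
  set ε : ℝ := Real.pi / 2 / M with hε
  have hε0 : 0 ≤ ε := by positivity
  have hMε : M * ε = Real.pi / 2 := by rw [hε]; field_simp
  set f : (K → ℝ) → ℝ := fun u ↦ u (κ u) with hf
  have hev : Measurable fun q : (K → ℝ) × K ↦ q.1 q.2 :=
    measurable_from_prod_countable_left fun k ↦ measurable_pi_apply k
  have hfm : Measurable f := hev.comp (measurable_id.prodMk hκ)
  set d : (K → ℝ) × (K → ℝ) → ℝ := fun p ↦
    (1 - Real.cos ε) * f p.1 + Real.sin ε * p.2 (κ p.1) with hd
  have hdm : Measurable d :=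
    ((hfm.comp measurable_fst).const_mul _).add
      ((hev.comp (measurable_snd.prodMk (hκ.comp measurable_fst))).const_mul _)
  let R : ℝ → (K → ℝ) × (K → ℝ) → (K → ℝ) × (K → ℝ) := fun θ p ↦
    ContinuousLinearMap.rotation θ p
  have hRm (θ : ℝ) : Measurable (R θ) := (ContinuousLinearMap.rotation θ).continuous.measurable
  have hRμ (θ : ℝ) : (μ.prod μ).map (R θ) = μ.prod μ := by
    refine IsGaussian.map_rotation_eq_self ?_ θ
    ext k
    have := (ContinuousLinearMap.proj (R := ℝ) (φ := fun _ : K ↦ ℝ) k).integral_comp_comm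
      (IsGaussian.integrable_id (μ := μ))
    simp only [id, ContinuousLinearMap.proj_apply] at this ⊢
    rw [← this, hμ, Pi.zero_apply]
  -- The coordinate that is maximal at angle `θ` is a competitor at angle `θ - ε`. Here `κ` replaces
  -- the gradient of the maximum.
  have hstep (θ : ℝ) (p) : f (R θ p).1 - f (R (θ - ε) p).1 ≤ d (R θ p) := by
    have h := hmax (R (θ - ε) p).1 (κ (R θ p).1)
    simp only [hf, hd, R, ContinuousLinearMap.rotation_apply, Pi.add_apply, Pi.smul_apply,
      smul_eq_mul, Real.cos_sub, Real.sin_sub] at h ⊢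
    nlinarith [h]
  have hsum (p) : f p.2 - f p.1 ≤ ∑ j ∈ Finset.range M, d (R ((j + 1) * ε) p) := by
    calc f p.2 - f p.1 = f (R (M * ε) p).1 - f (R (0 * ε) p).1 := by
          rw [hMε]; simp [R, ContinuousLinearMap.rotation_apply]
      _ = ∑ j ∈ Finset.range M, (f (R ((j + 1 : ℕ) * ε) p).1 - f (R (j * ε) p).1) := by
          rw [Finset.sum_range_sub fun j : ℕ ↦ f (R (j * ε) p).1, Nat.cast_zero]
      _ ≤ _ := Finset.sum_le_sum fun j _ ↦ by
          have := hstep ((j + 1) * ε) p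
          rw [show ((j : ℝ) + 1) * ε - ε = j * ε by ring] at this
          simpa only [Nat.cast_add, Nat.cast_one] using this
  -- Jensen with equal weights: by rotation invariance, all `M` exponentials have the same integral.
  have hexp (p) : Real.exp (c * (f p.2 - f p.1))
      ≤ ∑ j ∈ Finset.range M, (M : ℝ)⁻¹ * Real.exp (c * M * d (R ((j + 1) * ε) p)) := by
    have h1 := convexOn_exp.map_sum_le (t := Finset.range M) (w := fun _ ↦ (M : ℝ)⁻¹)
      (p := fun j ↦ c * M * d (R ((j + 1) * ε) p)) (fun _ _ ↦ by positivity)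
      (by simp [hM'.ne']) (fun _ _ ↦ Set.mem_univ _)
    simp only [smul_eq_mul] at h1
    refine le_trans (Real.exp_le_exp.2 ?_) h1
    calc c * (f p.2 - f p.1) ≤ c * ∑ j ∈ Finset.range M, d (R ((j + 1) * ε) p) := by
          gcongr; exact hsum p
      _ = _ := by
          rw [Finset.mul_sum]
          refine Finset.sum_congr rfl fun j _ ↦ ?_
          field_simp
  set s : ℝ := c * M * (1 - Real.cos ε) with hs
  have hs0 : 0 ≤ s := mul_nonneg (by positivity) (by linarith [Real.cos_le_one ε])
  have hs1 : s ≤ c * Real.pi ^ 2 / (8 * M) := by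
    calc s ≤ c * M * (ε ^ 2 / 2) := by
          refine mul_le_mul_of_nonneg_left ?_ (by positivity)
          linarith [Real.one_sub_sq_div_two_le_cos (x := ε)]
      _ = _ := by rw [hε]; field_simp; ring
  have hsin : 0 ≤ Real.sin ε := Real.sin_nonneg_of_nonneg_of_le_pi hε0 <| by
    rw [hε, div_div]
    exact div_le_self Real.pi_pos.le (by
      have : (1 : ℝ) ≤ M := by exact_mod_cast hM
      linarith)
  have hinner (u : K → ℝ) :
      ∫⁻ v, ENNReal.ofReal (Real.exp (c * M * Real.sin ε * v (κ u))) ∂μ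
        ≤ ENNReal.ofReal (Real.exp (σ ^ 2 * (c * (Real.pi / 2)) ^ 2 / 2)) := by
    refine (lintegral_exp_mul_eval_le _ (hμ _) (hσ _) _).trans ?_
    refine ENNReal.ofReal_le_ofReal (Real.exp_le_exp.2 ?_)
    have : c * M * Real.sin ε ≤ c * (Real.pi / 2) := by
      rw [mul_assoc, ← hMε]
      gcongr
      exact Real.sin_le hε0
    gcongr
  have houter : ∫⁻ u, ENNReal.ofReal (Real.exp (s * f u)) ∂μ
      ≤ 1 + ENNReal.ofReal (c * Real.pi ^ 2 / (8 * M)) *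
          (Fintype.card K * ENNReal.ofReal (Real.exp (σ ^ 2 / 2))) := by
    -- Since `0 ≤ s ≤ 1`, convexity of `exp` gives `exp (s f) ≤ 1 + s exp f`. The crude bound of
    -- `exp f` by a sum is harmless because `s` is of order `1 / M`.
    have hb (u : K → ℝ) : ENNReal.ofReal (Real.exp (s * f u)) ≤
        1 + ENNReal.ofReal s * ∑ k, ENNReal.ofReal (Real.exp (1 * u k)) := by
      have h1 := convexOn_exp.2 (Set.mem_univ 0) (Set.mem_univ (f u))
        (sub_nonneg.2 (hs1.trans hcM)) hs0 (by ring)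
      simp only [smul_eq_mul, mul_zero, zero_add, Real.exp_zero, mul_one] at h1
      have h2 : Real.exp (f u) ≤ ∑ k, Real.exp (1 * u k) := by
        simp only [one_mul, hf]
        exact Finset.single_le_sum (f := fun k ↦ Real.exp (u k))
          (fun k _ ↦ (Real.exp_pos _).le) (Finset.mem_univ _)
      rw [← ENNReal.ofReal_sum_of_nonneg fun _ _ ↦ (Real.exp_pos _).le, ← ENNReal.ofReal_mul hs0,
        ← ENNReal.ofReal_one, ← ENNReal.ofReal_add zero_le_one (by positivity)]
      refine ENNReal.ofReal_le_ofReal ?_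
      nlinarith [mul_le_mul_of_nonneg_left h2 hs0]
    calc _ ≤ ∫⁻ u, (1 + ENNReal.ofReal s * ∑ k, ENNReal.ofReal (Real.exp (1 * u k))) ∂μ :=
          lintegral_mono hb
      _ = 1 + ENNReal.ofReal s * ∑ k, ∫⁻ u, ENNReal.ofReal (Real.exp (1 * u k)) ∂μ := by
          rw [lintegral_add_left measurable_const, lintegral_const_mul _ (by fun_prop),
            lintegral_finsetSum _ (fun k _ ↦ by fun_prop)]
          simp
      _ ≤ 1 + ENNReal.ofReal (c * Real.pi ^ 2 / (8 * M)) *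
          ∑ k : K, ENNReal.ofReal (Real.exp (σ ^ 2 / 2)) := by
          gcongr with k
          simpa using lintegral_exp_mul_eval_le k (hμ k) (hσ k) 1
      _ = _ := by simp
  calc ∫⁻ p, ENNReal.ofReal (Real.exp (c * (p.2 (κ p.2) - p.1 (κ p.1)))) ∂(μ.prod μ)
      ≤ ∫⁻ p, ∑ j ∈ Finset.range M, ENNReal.ofReal (M : ℝ)⁻¹ *
          ENNReal.ofReal (Real.exp (c * M * d (R ((j + 1) * ε) p))) ∂(μ.prod μ) := by
        refine lintegral_mono fun p ↦ ?_
        simp only [← ENNReal.ofReal_mul (inv_nonneg.2 hM'.le)]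
        rw [← ENNReal.ofReal_sum_of_nonneg fun _ _ ↦ by positivity]
        exact ENNReal.ofReal_le_ofReal (hexp p)
    _ = ∑ j ∈ Finset.range M, ENNReal.ofReal (M : ℝ)⁻¹ *
          ∫⁻ p, ENNReal.ofReal (Real.exp (c * M * d p)) ∂(μ.prod μ) := by
        rw [lintegral_finsetSum _ fun j _ ↦ by fun_prop]
        refine Finset.sum_congr rfl fun j _ ↦ ?_
        rw [lintegral_const_mul _ (by fun_prop)]
        conv_rhs => rw [← hRμ ((j + 1) * ε), lintegral_map (by fun_prop) (hRm _)]
    _ = ∫⁻ p, ENNReal.ofReal (Real.exp (c * M * d p)) ∂(μ.prod μ) := by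
        rw [Finset.sum_const, Finset.card_range, nsmul_eq_mul, ← mul_assoc,
          ENNReal.ofReal_inv_of_pos hM', ENNReal.ofReal_natCast, ENNReal.mul_inv_cancel
            (by exact_mod_cast hM.ne') (ENNReal.natCast_ne_top _), one_mul]
    _ = ∫⁻ u, ENNReal.ofReal (Real.exp (s * f u)) *
          ∫⁻ v, ENNReal.ofReal (Real.exp (c * M * Real.sin ε * v (κ u))) ∂μ ∂μ := by
        rw [lintegral_prod _ (by fun_prop)]
        refine lintegral_congr fun u ↦ ?_
        rw [← lintegral_const_mul _ (by fun_prop)]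
        refine lintegral_congr fun v ↦ ?_
        rw [← ENNReal.ofReal_mul (Real.exp_pos _).le, ← Real.exp_add]
        congr 2
        simp only [hd, hs]
        ring
    _ ≤ ∫⁻ u, ENNReal.ofReal (Real.exp (s * f u)) *
          ENNReal.ofReal (Real.exp (σ ^ 2 * (c * (Real.pi / 2)) ^ 2 / 2)) ∂μ := by
        gcongr with u
        exact hinner u
    _ = ENNReal.ofReal (Real.exp (σ ^ 2 * (c * (Real.pi / 2)) ^ 2 / 2)) *
          ∫⁻ u, ENNReal.ofReal (Real.exp (s * f u)) ∂μ := by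
        rw [lintegral_mul_const _ (by fun_prop), mul_comm]
    _ ≤ _ := by gcongr

/-- As `M → ∞` the discretisation error vanishes. -/
lemma lintegral_exp_max_sub_max_le [Fintype K] [Nonempty K] [MeasurableSpace K]
    [MeasurableSingletonClass K] {μ : Measure (K → ℝ)} [IsGaussian μ] {σ : ℝ}
    (hμ : ∀ k, ∫ u, u k ∂μ = 0) (hσ : ∀ k, Var[fun u ↦ u k; μ] ≤ σ ^ 2)
    {κ : (K → ℝ) → K} (hκ : Measurable κ) (hmax : ∀ (u : K → ℝ) (l : K), u l ≤ u (κ u))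
    {c : ℝ} (hc : 0 ≤ c) :
    ∫⁻ p, ENNReal.ofReal (Real.exp (c * (p.2 (κ p.2) - p.1 (κ p.1)))) ∂(μ.prod μ)
      ≤ ENNReal.ofReal (Real.exp (σ ^ 2 * (c * (Real.pi / 2)) ^ 2 / 2)) := by
  have h0 : Filter.Tendsto (fun M : ℕ ↦ c * Real.pi ^ 2 / (8 * (M : ℝ))) Filter.atTop (nhds 0) :=
    Filter.Tendsto.const_div_atTop
      (tendsto_natCast_atTop_atTop.const_mul_atTop (by norm_num)) _
  have hC : (Fintype.card K * ENNReal.ofReal (Real.exp (σ ^ 2 / 2)) : ℝ≥0∞) ≠ ∞ :=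
    ENNReal.mul_ne_top (ENNReal.natCast_ne_top _) ENNReal.ofReal_ne_top
  have h1 := ENNReal.Tendsto.const_mul (a := ENNReal.ofReal
    (Real.exp (σ ^ 2 * (c * (Real.pi / 2)) ^ 2 / 2))) ((ENNReal.Tendsto.mul_const
      (ENNReal.tendsto_ofReal h0) (.inr hC)).const_add 1) (.inr ENNReal.ofReal_ne_top)
  rw [ENNReal.ofReal_zero, zero_mul, add_zero, mul_one] at h1
  refine ge_of_tendsto h1 ?_
  filter_upwards [Filter.eventually_gt_atTop 0, h0.eventually_le_const zero_lt_one] with M hM hcM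
  exact lintegral_exp_max_sub_max_le_aux hμ hσ hκ hmax hc hM hcM

/-- Gaussian concentration for the maximum of a centred Gaussian vector. -/
lemma measure_exists_ge_mul_measure_forall_le [Fintype K] {μ : Measure (K → ℝ)} [IsGaussian μ]
    {σ r : ℝ} (hμ : ∀ k, ∫ u, u k ∂μ = 0) (hσ : ∀ k, Var[fun u ↦ u k; μ] ≤ σ ^ 2) (hσ0 : 0 < σ)
    (hr : 0 ≤ r) :
    μ {u | ∃ k, 2 * r ≤ u k} * μ {u | ∀ k, u k ≤ r}
      ≤ ENNReal.ofReal (Real.exp (- (2 * r ^ 2 / (Real.pi ^ 2 * σ ^ 2)))) := by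
  cases isEmpty_or_nonempty K
  · simp
  let _ : MeasurableSpace K := ⊤
  obtain ⟨κ, hκ, hmax⟩ := exists_measurable_argmax K
  -- This `c` minimises `σ² (c π / 2)² / 2 - c r`, the exponent that Markov's inequality produces.
  set c : ℝ := 4 * r / (Real.pi ^ 2 * σ ^ 2) with hc
  have hc0 : 0 ≤ c := by positivity
  have hpi := Real.pi_pos
  have key := lintegral_exp_max_sub_max_le hμ hσ hκ hmax hc0
  have hev : Measurable fun q : (K → ℝ) × K ↦ q.1 q.2 :=
    measurable_from_prod_countable_left fun k ↦ measurable_pi_apply k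
  have hfm : Measurable fun u : K → ℝ ↦ u (κ u) := hev.comp (measurable_id.prodMk hκ)
  have hmarkov := mul_meas_ge_le_lintegral₀ (μ := μ.prod μ)
    (f := fun p ↦ ENNReal.ofReal (Real.exp (c * (p.2 (κ p.2) - p.1 (κ p.1)))))
    (((((hfm.comp measurable_snd).sub (hfm.comp measurable_fst)).const_mul c).exp).ennreal_ofReal
      |>.aemeasurable) (ENNReal.ofReal (Real.exp (c * r)))
  -- Comparing two independent copies, one with maximum at most `r` and one with maximum at least `2
  -- r`, avoids any mean or median of the maximum.
  have hsub : {u : K → ℝ | ∀ k, u k ≤ r} ×ˢ {u : K → ℝ | ∃ k, 2 * r ≤ u k} ⊆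
      {p | ENNReal.ofReal (Real.exp (c * r))
        ≤ ENNReal.ofReal (Real.exp (c * (p.2 (κ p.2) - p.1 (κ p.1))))} := by
    rintro ⟨y, x⟩ ⟨hy, k, hk⟩
    refine ENNReal.ofReal_le_ofReal (Real.exp_le_exp.2 (mul_le_mul_of_nonneg_left ?_ hc0))
    have := hy (κ y)
    have := hmax x k
    simp only at *
    linarith
  have hle := (mul_le_mul_right (measure_mono (μ := μ.prod μ) hsub) _).trans
    (hmarkov.trans key)
  rw [Measure.prod_prod] at hle
  have h3 : μ {u | ∃ k, 2 * r ≤ u k} * μ {u | ∀ k, u k ≤ r} =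
      ENNReal.ofReal (Real.exp (-(c * r))) * (ENNReal.ofReal (Real.exp (c * r)) *
        (μ {u : K → ℝ | ∀ k, u k ≤ r} * μ {u : K → ℝ | ∃ k, 2 * r ≤ u k})) := by
    rw [← mul_assoc, ← ENNReal.ofReal_mul (Real.exp_pos _).le, ← Real.exp_add]
    simp [mul_comm]
  rw [h3]
  refine (mul_le_mul_right hle _).trans ?_
  rw [← ENNReal.ofReal_mul (Real.exp_pos _).le, ← Real.exp_add]
  refine ENNReal.ofReal_le_ofReal (Real.exp_le_exp.2 (le_of_eq ?_))
  rw [hc]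
  field_simp
  ring

/-- Gaussian concentration for the supremum of a countable centred Gaussian family. -/
lemma ProbabilityTheory.IsGaussianProcess.measure_exists_ge_mul_measure_forall_le [Countable K] {Ω : Type*}
    [MeasurableSpace Ω] {P : Measure Ω} {X : K → Ω → ℝ} (hX : IsGaussianProcess X P)
    {σ r : ℝ} (hX0 : ∀ k, ∫ ω, X k ω ∂P = 0) (hσ : ∀ k, Var[X k; P] ≤ σ ^ 2) (hσ0 : 0 < σ)
    (hr : 0 ≤ r) :
    P {ω | ∃ k, 2 * r ≤ X k ω} * P {ω | ∀ k, X k ω ≤ r}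
      ≤ ENNReal.ofReal (Real.exp (- (2 * r ^ 2 / (Real.pi ^ 2 * σ ^ 2)))) := by
  classical
  have hfin (I : Finset K) : P {ω | ∃ k ∈ I, 2 * r ≤ X k ω} * P {ω | ∀ k, X k ω ≤ r}
      ≤ ENNReal.ofReal (Real.exp (- (2 * r ^ 2 / (Real.pi ^ 2 * σ ^ 2)))) := by
    have hG := hX.hasGaussianLaw I
    have hm := hG.aemeasurable
    set μ := P.map (fun ω ↦ I.restrict (X · ω)) with hμ
    have : IsGaussian μ := hG.isGaussian_map
    have hmk (k : I) : AEStronglyMeasurable (fun u : I → ℝ ↦ u k) μ :=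
      (measurable_pi_apply k).aestronglyMeasurable
    have := _root_.measure_exists_ge_mul_measure_forall_le (μ := μ) (σ := σ) (r := r)
      (fun k ↦ by rw [hμ, integral_map hm (hmk k)]; exact hX0 k)
      (fun k ↦ by
        rw [hμ, variance_map (measurable_pi_apply k).aemeasurable hm]
        exact hσ k) hσ0 hr
    refine le_trans ?_ this
    rw [hμ, Measure.map_apply_of_aemeasurable hm, Measure.map_apply_of_aemeasurable hm]
    · gcongr
      · rintro ω ⟨k, hk, h⟩
        exact ⟨⟨k, hk⟩, h⟩
      · exact fun ω h k ↦ h k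
    · rw [Set.ofPred_forall]
      exact .iInter fun l ↦ measurableSet_le (measurable_pi_apply _) measurable_const
    · rw [Set.ofPred_exists]
      exact .iUnion fun l ↦ measurableSet_le measurable_const (measurable_pi_apply _)
  have hU : {ω | ∃ k, 2 * r ≤ X k ω} = ⋃ I : Finset K, {ω | ∃ k ∈ I, 2 * r ≤ X k ω} := by
    ext ω
    simp only [Set.mem_ofPred_eq, Set.mem_iUnion]
    exact ⟨fun ⟨k, hk⟩ ↦ ⟨{k}, k, by simp, hk⟩, fun ⟨I, k, _, hk⟩ ↦ ⟨k, hk⟩⟩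
  have hmono : Monotone fun I : Finset K ↦ {ω | ∃ k ∈ I, 2 * r ≤ X k ω} :=
    fun I J hIJ ω ⟨k, hk, h⟩ ↦ ⟨k, hIJ hk, h⟩
  rw [hU, hmono.directed_le.measure_iUnion, ENNReal.iSup_mul]
  exact iSup_le hfin

end Concentration

/-! ### Correlations of increments and variances along chains. -/

/-- Both `p + q` and `p + r` are convex combinations of `p` and `p + q + r`, with swapped weights.
With `p` the gap between two intervals of lengths `q` and `r`, this decides the sign of the
covariance of their increments. -/
lemma ConvexOn.map_add_add_map_add_le {φ : ℝ → ℝ} (hφ : ConvexOn ℝ (Set.Ici 0) φ) {p q r : ℝ}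
    (hp : 0 ≤ p) (hq : 0 ≤ q) (hr : 0 ≤ r) : φ (p + q) + φ (p + r) ≤ φ p + φ (p + q + r) := by
  rcases (add_nonneg hq hr).eq_or_lt with h | h
  · obtain rfl : q = 0 := by linarith
    obtain rfl : r = 0 := by linarith
    simp
  have hp' : p ∈ Set.Ici (0 : ℝ) := hp
  have hs : p + q + r ∈ Set.Ici (0 : ℝ) := by simp only [Set.mem_Ici]; linarith
  have hsum : r / (q + r) + q / (q + r) = 1 := by field_simp; ring
  have h1 := hφ.2 hp' hs (by positivity : 0 ≤ r / (q + r)) (by positivity : 0 ≤ q / (q + r)) hsum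
  have h2 := hφ.2 hp' hs (by positivity : 0 ≤ q / (q + r)) (by positivity : 0 ≤ r / (q + r))
    (by rw [add_comm]; exact hsum)
  have e1 : r / (q + r) * p + q / (q + r) * (p + q + r) = p + q := by field_simp; ring
  have e2 : q / (q + r) * p + r / (q + r) * (p + q + r) = p + r := by field_simp; ring
  simp only [smul_eq_mul, e1, e2] at h1 h2
  have : r / (q + r) = 1 - q / (q + r) := by linarith
  rw [this] at h1 h2
  nlinarith

lemma Fin.sum_univ_succ_sub_castSucc {A : Type*} [AddCommGroup A] {n : ℕ} (f : Fin (n + 1) → A) :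
    ∑ i : Fin n, (f i.succ - f i.castSucc) = f (Fin.last n) - f 0 := by
  induction n with
  | zero => simp
  | succ n ih =>
    have := ih fun i ↦ f i.castSucc
    simp only [Fin.castSucc_zero] at this
    rw [Fin.sum_univ_castSucc]
    simp only [Fin.succ_castSucc, this, Fin.succ_last]
    abel

namespace IsFractionalBrownianMotion

variable {Ω : Type*} [MeasurableSpace Ω] {P : Measure Ω} {H : ℝ} {B : ℝ≥0 → Ω → ℝ}

lemma memLp_two (hB : IsFractionalBrownianMotion H B P) (t : ℝ≥0) : MemLp (B t) 2 P :=
  (hB.isGaussianProcess.hasGaussianLaw_eval t).memLp_two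

lemma memLp_two_sub (hB : IsFractionalBrownianMotion H B P) (s t : ℝ≥0) :
    MemLp (B t - B s) 2 P :=
  (hB.memLp_two t).sub (hB.memLp_two s)

variable [IsProbabilityMeasure P]

lemma covariance_sub_sub (hB : IsFractionalBrownianMotion H B P) (u v w z : ℝ≥0) :
    cov[B v - B u, B z - B w; P] = (|(v : ℝ) - w| ^ (2 * H) + |(u : ℝ) - z| ^ (2 * H)
      - |(v : ℝ) - z| ^ (2 * H) - |(u : ℝ) - w| ^ (2 * H)) / 2 := by
  rw [ProbabilityTheory.covariance_sub_sub (hB.memLp_two _) (hB.memLp_two _) (hB.memLp_two _)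
    (hB.memLp_two _)]
  simp only [hB.covariance_eq]
  ring

lemma variance_sub (hB : IsFractionalBrownianMotion H B P) (hH : 0 < H) (u v : ℝ≥0) :
    Var[B v - B u; P] = |(v : ℝ) - u| ^ (2 * H) := by
  rw [← covariance_self (hB.memLp_two_sub _ _).aestronglyMeasurable.aemeasurable,
    hB.covariance_sub_sub, abs_sub_comm (u : ℝ) v]
  simp [Real.zero_rpow (by positivity : 2 * H ≠ 0)]

lemma covariance_sub_sub_of_le (hB : IsFractionalBrownianMotion H B P) {u v w z : ℝ≥0}
    (huv : u ≤ v) (hvw : v ≤ w) (hwz : w ≤ z) :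
    cov[B v - B u, B z - B w; P] = (((w : ℝ) - v) ^ (2 * H)
      + ((w : ℝ) - v + (v - u) + (z - w)) ^ (2 * H)
      - ((w : ℝ) - v + (z - w)) ^ (2 * H) - ((w : ℝ) - v + (v - u)) ^ (2 * H)) / 2 := by
  have huv' : (u : ℝ) ≤ v := huv
  have hvw' : (v : ℝ) ≤ w := hvw
  have hwz' : (w : ℝ) ≤ z := hwz
  rw [hB.covariance_sub_sub, abs_of_nonpos (by linarith), abs_of_nonpos (by linarith),
    abs_of_nonpos (by linarith), abs_of_nonpos (by linarith)]
  ring_nf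

lemma covariance_sub_sub_nonneg (hB : IsFractionalBrownianMotion H B P) (hH : 1 / 2 ≤ H)
    {u v w z : ℝ≥0} (huv : u ≤ v) (hvw : v ≤ w) (hwz : w ≤ z) :
    0 ≤ cov[B v - B u, B z - B w; P] := by
  have := (convexOn_rpow (p := 2 * H) (by linarith)).map_add_add_map_add_le
    (p := w - v) (q := v - u) (r := z - w) (sub_nonneg.2 hvw) (sub_nonneg.2 huv) (sub_nonneg.2 hwz)
  rw [hB.covariance_sub_sub_of_le huv hvw hwz]
  linarith

lemma covariance_sub_sub_nonpos (hB : IsFractionalBrownianMotion H B P) (hH0 : 0 < H)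
    (hH : H ≤ 1 / 2) {u v w z : ℝ≥0} (huv : u ≤ v) (hvw : v ≤ w) (hwz : w ≤ z) :
    cov[B v - B u, B z - B w; P] ≤ 0 := by
  have := (Real.concaveOn_rpow (p := 2 * H) (by linarith) (by linarith)).neg.map_add_add_map_add_le
    (p := w - v) (q := v - u) (r := z - w) (sub_nonneg.2 hvw) (sub_nonneg.2 huv) (sub_nonneg.2 hwz)
  simp only [Pi.neg_apply] at this
  rw [hB.covariance_sub_sub_of_le huv hvw hwz]
  linarith

/-- Nested increments are nonnegatively correlated for every `H > 0`, because `t ^ (2H)` is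
increasing. For `H ≤ 1 / 2` this makes the row sums of the covariance matrix of a chain nonnegative.
-/
lemma covariance_sub_sub_nonneg_of_mem (hB : IsFractionalBrownianMotion H B P) (hH : 0 < H)
    {u v w z : ℝ≥0} (hwu : w ≤ u) (huv : u ≤ v) (hvz : v ≤ z) :
    0 ≤ cov[B v - B u, B z - B w; P] := by
  have hwu' : (w : ℝ) ≤ u := hwu
  have huv' : (u : ℝ) ≤ v := huv
  have hvz' : (v : ℝ) ≤ z := hvz
  rw [hB.covariance_sub_sub, abs_of_nonneg (by linarith), abs_of_nonpos (by linarith),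
    abs_of_nonpos (by linarith), abs_of_nonneg (by linarith)]
  have h1 : ((u : ℝ) - w) ^ (2 * H) ≤ ((v : ℝ) - w) ^ (2 * H) :=
    Real.rpow_le_rpow (by linarith) (by linarith) (by linarith)
  have h2 : (-((v : ℝ) - z)) ^ (2 * H) ≤ (-((u : ℝ) - z)) ^ (2 * H) :=
    Real.rpow_le_rpow (by linarith) (by linarith) (by linarith)
  linarith

section Chain

variable {n : ℕ} {s : Fin (n + 1) → ℝ≥0} {a : Fin n → ℝ}

lemma variance_sum_mul_sub (hB : IsFractionalBrownianMotion H B P) (s : Fin (n + 1) → ℝ≥0)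
    (a : Fin n → ℝ) :
    Var[∑ i, a i • (B (s i.succ) - B (s i.castSucc)); P] = ∑ i, ∑ j, a i * a j *
      cov[B (s i.succ) - B (s i.castSucc), B (s j.succ) - B (s j.castSucc); P] := by
  rw [variance_sum fun i ↦ (hB.memLp_two_sub _ _).const_smul _]
  simp only [covariance_smul_left, covariance_smul_right]
  exact Finset.sum_congr rfl fun i _ ↦ Finset.sum_congr rfl fun j _ ↦ by ring

/-- For `H ≥ 1 / 2` the increments are positively correlated, which bounds the variance of a
combination of successive increments by that of the total increment. -/
lemma variance_sum_mul_sub_le_of_half_le (hB : IsFractionalBrownianMotion H B P) (hH : 1 / 2 ≤ H)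
    (hs : Monotone s) (ha : ∀ i, |a i| ≤ 1) :
    Var[∑ i, a i • (B (s i.succ) - B (s i.castSucc)); P]
      ≤ ((s (Fin.last n) : ℝ) - s 0) ^ (2 * H) := by
  have hpos (i j : Fin n) :
      0 ≤ cov[B (s i.succ) - B (s i.castSucc), B (s j.succ) - B (s j.castSucc); P] := by
    rcases lt_trichotomy i j with h | rfl | h
    · exact hB.covariance_sub_sub_nonneg hH (hs i.castSucc_le_succ)
        (hs (Fin.succ_le_castSucc_iff.2 h)) (hs j.castSucc_le_succ)
    · exact hB.covariance_sub_sub_nonneg_of_mem (by linarith) le_rfl (hs i.castSucc_le_succ) le_rfl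
    · rw [covariance_comm]
      exact hB.covariance_sub_sub_nonneg hH (hs j.castSucc_le_succ)
        (hs (Fin.succ_le_castSucc_iff.2 h)) (hs i.castSucc_le_succ)
  have htot : Var[B (s (Fin.last n)) - B (s 0); P] = ∑ i : Fin n, ∑ j : Fin n,
      cov[B (s i.succ) - B (s i.castSucc), B (s j.succ) - B (s j.castSucc); P] := by
    simpa [Fin.sum_univ_succ_sub_castSucc fun i ↦ B (s i)] using
      hB.variance_sum_mul_sub s fun _ ↦ 1
  have hle : (s 0 : ℝ) ≤ s (Fin.last n) := hs (Fin.zero_le _)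
  rw [← abs_of_nonneg (sub_nonneg.2 hle), ← hB.variance_sub (by linarith), htot,
    hB.variance_sum_mul_sub]
  gcongr with i _ j _
  refine mul_le_of_le_one_left (hpos i j) ((le_abs_self _).trans ?_)
  rw [abs_mul]
  exact mul_le_one₀ (ha i) (abs_nonneg _) (ha j)

/-- For `H ≤ 1 / 2` the increments are negatively correlated, so that the covariance matrix of
successive increments is dominated by twice its diagonal. -/
lemma variance_sum_mul_sub_le_of_le_half (hB : IsFractionalBrownianMotion H B P) (hH0 : 0 < H)
    (hH : H ≤ 1 / 2) (hs : Monotone s) :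
    Var[∑ i, a i • (B (s i.succ) - B (s i.castSucc)); P]
      ≤ 2 * ∑ i, a i ^ 2 * ((s i.succ : ℝ) - s i.castSucc) ^ (2 * H) := by
  set C : Fin n → Fin n → ℝ := fun i j ↦
    cov[B (s i.succ) - B (s i.castSucc), B (s j.succ) - B (s j.castSucc); P] with hC
  have hsymm (i j) : C i j = C j i := covariance_comm _ _
  have hneg (i j : Fin n) (hij : i ≠ j) : C i j ≤ 0 := by
    rcases hij.lt_or_gt with h | h
    · exact hB.covariance_sub_sub_nonpos hH0 hH (hs i.castSucc_le_succ)
        (hs (Fin.succ_le_castSucc_iff.2 h)) (hs j.castSucc_le_succ)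
    · rw [hsymm]
      exact hB.covariance_sub_sub_nonpos hH0 hH (hs j.castSucc_le_succ)
        (hs (Fin.succ_le_castSucc_iff.2 h)) (hs i.castSucc_le_succ)
  have hdiag (i : Fin n) : C i i = ((s i.succ : ℝ) - s i.castSucc) ^ (2 * H) := by
    have hle : (s i.castSucc : ℝ) ≤ s i.succ := hs i.castSucc_le_succ
    rw [hC]
    simp only
    rw [covariance_self (hB.memLp_two_sub _ _).aestronglyMeasurable.aemeasurable,
      hB.variance_sub hH0, abs_of_nonneg (sub_nonneg.2 hle)]
  have hrow (i : Fin n) : 0 ≤ ∑ j, C i j := by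
    have : ∑ j, C i j =
        cov[B (s i.succ) - B (s i.castSucc), B (s (Fin.last n)) - B (s 0); P] := by
      rw [← Fin.sum_univ_succ_sub_castSucc fun i ↦ B (s i),
        covariance_sum_right (fun j ↦ hB.memLp_two_sub _ _) (hB.memLp_two_sub _ _)]
    rw [this]
    exact hB.covariance_sub_sub_nonneg_of_mem hH0 (hs (Fin.zero_le _)) (hs i.castSucc_le_succ)
      (hs (Fin.le_last _))
  -- Off the diagonal `C i j ≤ 0` and `a i * a j ≥ -(a i ^ 2 + a j ^ 2) / 2`. On the diagonal there
  -- is equality. Summing leaves twice the diagonal minus a combination of the nonnegative row sums.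
  have hterm (i j : Fin n) : a i * a j * C i j ≤
      (if i = j then 2 * a i ^ 2 * C i i else 0) - (a i ^ 2 + a j ^ 2) / 2 * C i j := by
    split_ifs with h
    · subst h
      exact le_of_eq (by ring)
    · nlinarith [mul_nonneg (sq_nonneg (a i + a j)) (neg_nonneg.2 (hneg i j h))]
  have hsw : ∑ i, ∑ j, a j ^ 2 * C i j = ∑ i, a i ^ 2 * ∑ j, C i j := by
    rw [Finset.sum_comm]
    simp only [Finset.mul_sum, hsymm]
  calc Var[∑ i, a i • (B (s i.succ) - B (s i.castSucc)); P]
      = ∑ i, ∑ j, a i * a j * C i j := hB.variance_sum_mul_sub s a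
    _ ≤ ∑ i, ∑ j, ((if i = j then 2 * a i ^ 2 * C i i else 0)
          - (a i ^ 2 + a j ^ 2) / 2 * C i j) := by
        gcongr with i _ j _
        exact hterm i j
    _ = 2 * ∑ i, a i ^ 2 * C i i - ∑ i, a i ^ 2 * ∑ j, C i j := by
        have : ∑ i, ∑ j, (a i ^ 2 + a j ^ 2) / 2 * C i j = ∑ i, a i ^ 2 * ∑ j, C i j := by
          have : ∑ i, ∑ j, (a i ^ 2 + a j ^ 2) / 2 * C i j =
              (∑ i, ∑ j, a i ^ 2 * C i j + ∑ i, ∑ j, a j ^ 2 * C i j) / 2 := by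
            simp only [← Finset.sum_add_distrib, Finset.sum_div]
            exact Finset.sum_congr rfl fun i _ ↦ Finset.sum_congr rfl fun j _ ↦ by ring
          rw [this, hsw]
          simp only [Finset.mul_sum]
          ring
        simp only [Finset.sum_sub_distrib, this]
        simp [Finset.mul_sum, mul_assoc]
    _ ≤ 2 * ∑ i, a i ^ 2 * C i i :=
        sub_le_self _ (Finset.sum_nonneg fun i _ ↦ mul_nonneg (sq_nonneg _) (hrow i))
    _ = _ := by simp only [hdiag]

end Chain

end IsFractionalBrownianMotion

/-! ### From chains of times to a tail bound. -/

section Tail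

open TopologicalSpace in
/-- The fluctuations of a continuous path up to time `T` can be seen, up to a factor two, along a
chain of times in a countable dense set. -/
lemma exists_denseSeq_chain {δ : ℝ} {x : ℝ≥0 → ℝ} (hx : Continuous x) (hδ : 0 < δ) {T : ℝ≥0}
    {n : ℕ} (h : fluctuationTime δ x n ≤ T) :
    ∃ s : Fin (n + 1) → ℕ, Monotone (fun i ↦ denseSeq ℝ≥0 (s i)) ∧
      (∀ i, denseSeq ℝ≥0 (s i) ≤ T + 1) ∧
      ∀ i : Fin n, δ / 2 < |x (denseSeq ℝ≥0 (s i.succ)) - x (denseSeq ℝ≥0 (s i.castSucc))| := by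
  obtain ⟨t, htm, htT, htδ⟩ := exists_strictMono_of_fluctuationTime_le hx hδ h
  -- The slack in `T + 1` and `δ / 2` makes every condition strict, hence open, so density applies.
  set U : Set (Fin (n + 1) → ℝ≥0) := (⋂ i : Fin n, {s | s i.castSucc < s i.succ}) ∩
    ((⋂ i, {s | s i < T + 1}) ∩ ⋂ i : Fin n, {s | δ / 2 < |x (s i.succ) - x (s i.castSucc)|})
  have hU : IsOpen U := by
    refine (isOpen_iInter_of_finite fun i ↦ ?_).inter
      ((isOpen_iInter_of_finite fun i ↦ ?_).inter (isOpen_iInter_of_finite fun i ↦ ?_))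
    · exact isOpen_lt (continuous_apply _) (continuous_apply _)
    · exact isOpen_lt (continuous_apply _) continuous_const
    · exact isOpen_lt continuous_const
        ((hx.comp (continuous_apply i.succ)).sub (hx.comp (continuous_apply i.castSucc))).abs
  have ht : t ∈ U := by
    simp only [U, Set.mem_inter_iff, Set.mem_iInter, Set.mem_ofPred_eq]
    exact ⟨fun i ↦ htm i.castSucc_lt_succ, fun i ↦ (htT i).trans_lt (by simp),
      fun i ↦ (half_lt_self hδ).trans_le (htδ i)⟩
  obtain ⟨s, hs⟩ := (DenseRange.piMap fun _ : Fin (n + 1) ↦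
    denseRange_denseSeq ℝ≥0).exists_mem_open hU ⟨t, ht⟩
  simp only [U, Set.mem_inter_iff, Set.mem_iInter, Set.mem_ofPred_eq, Pi.map_apply] at hs
  exact ⟨s, (Fin.strictMono_iff_lt_succ.2 hs.1).monotone, fun i ↦ (hs.2.1 i).le, hs.2.2⟩

/-- In a chain of times bounded by `S`, all but `S / η` of the steps have length at most `η`. -/
lemma le_card_filter_le_add {n m : ℕ} {s : Fin (n + 1) → ℝ≥0} (hs : Monotone s) {S η : ℝ≥0}
    (hS : s (Fin.last n) ≤ S) (hη : 0 < η) (hn : m + ⌈S / η⌉₊ ≤ n) :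
    m ≤ (Finset.univ.filter fun i : Fin n ↦ s i.succ ≤ s i.castSucc + η).card := by
  have hcard := Finset.card_filter_add_card_filter_not (s := Finset.univ)
    (fun i : Fin n ↦ s i.succ ≤ s i.castSucc + η)
  rw [Finset.card_univ, Fintype.card_fin] at hcard
  suffices hL : (Finset.univ.filter fun i : Fin n ↦ ¬ s i.succ ≤ s i.castSucc + η).card
      ≤ ⌈S / η⌉₊ by omega
  set J := Finset.univ.filter fun i : Fin n ↦ ¬ s i.succ ≤ s i.castSucc + η with hJ
  have hstep (i : Fin n) : (0 : ℝ) ≤ s i.succ - s i.castSucc :=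
    sub_nonneg.2 (NNReal.coe_le_coe.2 (hs i.castSucc_le_succ))
  have h1 : (J.card : ℝ) * η ≤ S := by
    calc (J.card : ℝ) * η = ∑ i ∈ J, (η : ℝ) := by simp
      _ ≤ ∑ i ∈ J, ((s i.succ : ℝ) - s i.castSucc) := by
          refine Finset.sum_le_sum fun i hi ↦ ?_
          have := not_le.1 (Finset.mem_filter.1 hi).2
          have : ((s i.castSucc + η : ℝ≥0) : ℝ) < s i.succ := this
          push_cast at this
          linarith
      _ ≤ ∑ i : Fin n, ((s i.succ : ℝ) - s i.castSucc) :=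
          Finset.sum_le_sum_of_subset_of_nonneg (Finset.subset_univ _) fun i _ _ ↦ hstep i
      _ = (s (Fin.last n) : ℝ) - s 0 := Fin.sum_univ_succ_sub_castSucc fun i ↦ (s i : ℝ)
      _ ≤ S := by
          have h0 : (0 : ℝ) ≤ s 0 := (s 0).coe_nonneg
          have h1 : (s (Fin.last n) : ℝ) ≤ S := hS
          linarith
  have h2 : (J.card : ℝ≥0) ≤ S / η := by
    rw [le_div_iff₀ hη]
    exact_mod_cast h1
  exact_mod_cast h2.trans (Nat.le_ceil _)

variable {Ω : Type*} [MeasurableSpace Ω] {P : Measure Ω} [IsProbabilityMeasure P]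
  {B : ℝ≥0 → Ω → ℝ}

/-- The event that `B` oscillates by at most `ε` over times at distance `η` in `[0, S]`. -/
def smallOscillation (B : ℝ≥0 → Ω → ℝ) (ε : ℝ) (S η : ℝ≥0) : Set Ω :=
  {ω | ∀ u v : ℝ≥0, u ≤ v → v ≤ S → v ≤ u + η → |B v ω - B u ω| ≤ ε}

/-- Continuous paths are uniformly continuous on `[0, S]`, so these events increase to one of full
measure as `η` decreases to `0`. Continuity of `P` along increasing unions needs no measurability of
the events. -/
lemma exists_half_le_measure_smallOscillation (hc : ∀ᵐ ω ∂P, Continuous fun t ↦ B t ω)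
    {ε : ℝ} (hε : 0 < ε) (S : ℝ≥0) :
    ∃ η₀ : ℝ≥0, 0 < η₀ ∧ ∀ η ≤ η₀, 1 / 2 ≤ P (smallOscillation B ε S η) := by
  have hanti {η η' : ℝ≥0} (h : η ≤ η') : smallOscillation B ε S η' ⊆ smallOscillation B ε S η :=
    fun ω hω u v huv hv hη ↦ hω u v huv hv (hη.trans (by gcongr))
  have hmono : Monotone fun k : ℕ ↦ smallOscillation B ε S (1 / ((k : ℝ≥0) + 1)) :=
    fun i j hij ↦ hanti (by gcongr)
  have hunion : P (⋃ k : ℕ, smallOscillation B ε S (1 / ((k : ℝ≥0) + 1))) = 1 := by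
    refine le_antisymm prob_le_one ?_
    rw [← measure_univ (μ := P)]
    refine measure_mono_ae ?_
    filter_upwards [hc] with ω hω _
    have huc := (isCompact_Icc (a := 0) (b := S)).uniformContinuousOn_of_continuous
      hω.continuousOn
    obtain ⟨θ, hθ, hθε⟩ := Metric.uniformContinuousOn_iff.1 huc ε hε
    obtain ⟨k, hk⟩ := exists_nat_one_div_lt hθ
    refine Set.mem_iUnion.2 ⟨k, fun u v huv hv hvk ↦ ?_⟩
    have huv' : (u : ℝ) ≤ v := huv
    have hvk' : ((v : ℝ≥0) : ℝ) ≤ (u + 1 / ((k : ℝ≥0) + 1) : ℝ≥0) := hvk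
    push_cast at hvk'
    refine (hθε v ⟨zero_le, hv⟩ u ⟨zero_le, huv.trans hv⟩ ?_).le
    rw [NNReal.dist_eq, abs_of_nonneg (sub_nonneg.2 huv')]
    linarith
  rw [hmono.directed_le.measure_iUnion] at hunion
  obtain ⟨k, hk⟩ := lt_iSup_iff.1 (show (1 / 2 : ℝ≥0∞) <
    ⨆ k : ℕ, P (smallOscillation B ε S (1 / ((k : ℝ≥0) + 1))) by
      rw [hunion]; exact ENNReal.div_lt_of_lt_mul (by norm_num))
  exact ⟨1 / ((k : ℝ≥0) + 1), by positivity, fun η hη ↦ hk.le.trans (measure_mono (hanti hη))⟩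

open TopologicalSpace in
-- The passage from variances to tails: `hvar` is the only place where the size of `H` will enter.
lemma IsFractionalBrownianMotion.measure_le_fluctuationNumber_le {H : ℝ}
    (hB : IsFractionalBrownianMotion H B P) {δ : ℝ} (hδ : 0 < δ) {T η : ℝ≥0} (hη : 0 < η)
    (hosc : 1 / 2 ≤ P (smallOscillation B (δ / 4) (T + 1) η)) {m : ℕ} {σ : ℝ} (hσ : 0 < σ)
    (hvar : ∀ (n : ℕ) (s : Fin (n + 1) → ℝ≥0) (a : Fin n → ℝ), Monotone s → (∀ i, s i ≤ T + 1) →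
      (∀ i, |a i| ≤ 1) → (∀ i, a i ≠ 0 → s i.succ ≤ s i.castSucc + η) → ∑ i, a i ^ 2 = m →
      Var[∑ i, a i • (B (s i.succ) - B (s i.castSucc)); P] ≤ σ ^ 2) :
    P {ω | ((m + ⌈(T + 1) / η⌉₊ : ℕ) : ℕ∞) ≤ fluctuationNumber δ T fun t ↦ B t ω}
      ≤ ENNReal.ofReal (2 * Real.exp (-(2 * (m * (δ / 4)) ^ 2 / (Real.pi ^ 2 * σ ^ 2)))) := by
  classical
  set n := m + ⌈(T + 1) / η⌉₊ with hn
  set q := denseSeq ℝ≥0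
  -- Chains in the dense sequence with a sign for each step: the sign `0` discards a step, and
  -- exactly `m` steps, all of length at most `η`, are kept.
  let K := {k : (Fin (n + 1) → ℕ) × (Fin n → SignType) // Monotone (fun i ↦ q (k.1 i)) ∧
    (∀ i, q (k.1 i) ≤ T + 1) ∧
    (∀ i, k.2 i ≠ 0 → q (k.1 i.succ) ≤ q (k.1 i.castSucc) + η) ∧
    ∑ i, |(k.2 i : ℝ)| = m}
  let X : K → Ω → ℝ := fun k ↦
    ∑ i, (k.1.2 i : ℝ) • (B (q (k.1.1 i.succ)) - B (q (k.1.1 i.castSucc)))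
  have hXapp (k : K) (ω : Ω) : X k ω =
      ∑ i, (k.1.2 i : ℝ) * (B (q (k.1.1 i.succ)) ω - B (q (k.1.1 i.castSucc)) ω) := by
    simp [X]
  have habs (b : SignType) : |(b : ℝ)| ≤ 1 := by cases b <;> simp
  have hsq (b : SignType) : (b : ℝ) ^ 2 = |(b : ℝ)| := by cases b <;> simp
  have hG : IsGaussianProcess X P := by
    refine hB.isGaussianProcess.of_isGaussianProcess fun k ↦ ?_
    refine ⟨Finset.univ.image fun i ↦ q (k.1.1 i), ∑ i, (k.1.2 i : ℝ) •
      (ContinuousLinearMap.proj ⟨q (k.1.1 i.succ), Finset.mem_image_of_mem _ (Finset.mem_univ _)⟩ -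
       ContinuousLinearMap.proj ⟨q (k.1.1 i.castSucc),
        Finset.mem_image_of_mem _ (Finset.mem_univ _)⟩), fun ω ↦ ?_⟩
    simp [hXapp]
  have hint (t : ℝ≥0) : Integrable (B t) P := (hB.memLp_two t).integrable (by norm_num)
  have hX0 (k : K) : ∫ ω, X k ω ∂P = 0 := by
    simp only [hXapp]
    rw [integral_finsetSum]
    swap
    · exact fun i _ ↦ ((hint (q (k.1.1 i.succ))).sub (hint (q (k.1.1 i.castSucc)))).const_mul (k.1.2 i : ℝ)
    refine Finset.sum_eq_zero fun i _ ↦ ?_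
    rw [integral_const_mul, integral_sub (hint _) (hint _), hB.integral_eq_zero,
      hB.integral_eq_zero, sub_zero, mul_zero]
  have hXσ (k : K) : Var[X k; P] ≤ σ ^ 2 :=
    hvar n (fun i ↦ q (k.1.1 i)) (fun i ↦ k.1.2 i) k.2.1 k.2.2.1 (fun i ↦ habs _)
      (fun i hi ↦ k.2.2.2.1 i fun h ↦ hi (by simp [h])) (by simp only [hsq, k.2.2.2.2])
  have hconc := hG.measure_exists_ge_mul_measure_forall_le (r := m * (δ / 4)) hX0 hXσ hσ
    (by positivity)
  have hlow : 1 / 2 ≤ P {ω | ∀ k, X k ω ≤ m * (δ / 4)} := by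
    refine hosc.trans (measure_mono fun ω hω k ↦ ?_)
    rw [hXapp]
    refine le_trans ?_ (congrArg (· * (δ / 4)) k.2.2.2.2).le
    rw [Finset.sum_mul]
    refine Finset.sum_le_sum fun i _ ↦ (le_abs_self _).trans ?_
    rw [abs_mul]
    by_cases h : k.1.2 i = 0
    · simp [h]
    · gcongr
      exact hω _ _ (k.2.1 i.castSucc_le_succ) (k.2.2.1 _) (k.2.2.2.1 i h)
  have hup : P {ω | (n : ℕ∞) ≤ fluctuationNumber δ T fun t ↦ B t ω}
      ≤ P {ω | ∃ k, 2 * (m * (δ / 4)) ≤ X k ω} := by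
    refine measure_mono_ae ?_
    filter_upwards [hB.continuous_paths] with ω hω h
    have h := natCast_le_fluctuationNumber_iff.1 h
    obtain ⟨s, hs, hsT, hsδ⟩ := exists_denseSeq_chain hω hδ h
    obtain ⟨J, hJ, hJm⟩ := Finset.exists_subset_card_eq
      (le_card_filter_le_add hs (hsT _) hη hn.ge)
    let a : Fin n → SignType := fun i ↦
      if i ∈ J then SignType.sign (B (q (s i.succ)) ω - B (q (s i.castSucc)) ω) else 0
    have hpos (i : Fin n) : 0 < |B (q (s i.succ)) ω - B (q (s i.castSucc)) ω| :=
      (half_pos hδ).trans (hsδ i)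
    -- No increment of the chain vanishes, so every step in `J` really has sign `±1`.
    have ha (i : Fin n) : |(a i : ℝ)| = if i ∈ J then 1 else 0 := by
      simp only [a]
      split_ifs
      · rcases (abs_pos.1 (hpos i)).lt_or_gt with h | h <;> simp [h]
      · simp
    refine ⟨⟨(s, a), hs, hsT, fun i hi ↦ ?_, by simp [ha, hJm]⟩, ?_⟩
    · have hiJ : i ∈ J := by
        by_contra hcon
        exact hi (by simp [a, hcon])
      exact (Finset.mem_filter.1 (hJ hiJ)).2
    · rw [hXapp]
      calc 2 * (m * (δ / 4)) = ∑ i ∈ J, δ / 2 := by simp [hJm]; ring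
        _ ≤ ∑ i ∈ J, |B (q (s i.succ)) ω - B (q (s i.castSucc)) ω| :=
            Finset.sum_le_sum fun i _ ↦ (hsδ i).le
        _ = ∑ i, if i ∈ J then |B (q (s i.succ)) ω - B (q (s i.castSucc)) ω| else 0 := by
            simp
        _ = _ := Finset.sum_congr rfl fun i _ ↦ by
            simp only [a]
            split_ifs
            · rw [sign_mul_self]
            · simp
  have h2 := (mul_le_mul' hup hlow).trans hconc
  rw [ENNReal.ofReal_mul zero_le_two]
  calc _ = ENNReal.ofReal 2 *
        (P {ω | (n : ℕ∞) ≤ fluctuationNumber δ T fun t ↦ B t ω} * (1 / 2)) := by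
        rw [mul_comm, mul_assoc, ENNReal.ofReal_ofNat, ENNReal.div_mul_cancel] <;> simp
    _ ≤ _ := by gcongr

end Tail

/-! ### From tails to moments. -/

section Moments

variable {Ω : Type*} [MeasurableSpace Ω] {P : Measure Ω}

/-- `G N` is at most the term `n = N` of `∑ n, exp (φ n) 1_{N ≥ n}`, and the spare factor `exp (-n)`
in the tail makes the expectation of this sum converge. No bound on `G ⊤` is needed, as the tail
forces `N` to be almost surely finite. -/
lemma lintegral_comp_lt_top_of_tail_le {N : Ω → ℕ∞} (hN : AEMeasurable N P) {φ : ℕ → ℝ}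
    (hφ : ∀ n, 0 ≤ φ n) {C : ℝ}
    (htail : ∀ n : ℕ, P {ω | (n : ℕ∞) ≤ N ω} ≤ ENNReal.ofReal (C * Real.exp (-φ n - n)))
    {G : ℕ∞ → ℝ≥0∞} (hG : ∀ n : ℕ, G n ≤ ENNReal.ofReal (Real.exp (φ n))) :
    ∫⁻ ω, G (N ω) ∂P < ∞ := by
  have hexp : Summable fun n : ℕ ↦ |C| * Real.exp (-n) :=
    (Real.summable_exp_neg_nat).mul_left _
  have htail' (n : ℕ) : ENNReal.ofReal (Real.exp (φ n)) * P {ω | (n : ℕ∞) ≤ N ω}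
      ≤ ENNReal.ofReal (|C| * Real.exp (-n)) := by
    calc _ ≤ ENNReal.ofReal (Real.exp (φ n)) * ENNReal.ofReal (C * Real.exp (-φ n - n)) := by
          gcongr; exact htail n
      _ = ENNReal.ofReal (C * Real.exp (-n)) := by
          rw [← ENNReal.ofReal_mul (Real.exp_pos _).le, mul_left_comm, ← Real.exp_add]
          ring_nf
      _ ≤ _ := by gcongr; exact le_abs_self C
  have htop : P {ω | N ω = ⊤} = 0 := by
    refine le_antisymm (ge_of_tendsto' (x := Filter.atTop) (f := fun n : ℕ ↦
      ENNReal.ofReal (|C| * Real.exp (-n))) ?_ fun n ↦ ?_) zero_le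
    · rw [← ENNReal.ofReal_zero]
      exact ENNReal.tendsto_ofReal hexp.tendsto_atTop_zero
    · refine le_trans ?_ (htail' n)
      calc P {ω | N ω = ⊤} ≤ P {ω | (n : ℕ∞) ≤ N ω} :=
            measure_mono fun ω (hω : N ω = ⊤) ↦ show (n : ℕ∞) ≤ N ω by rw [hω]; exact le_top
        _ ≤ _ := le_mul_of_one_le_left' (by simpa using hφ n)
  calc ∫⁻ ω, G (N ω) ∂P
      ≤ ∫⁻ ω, ∑' n : ℕ, (Set.Ici (n : ℕ∞)).indicator
          (fun _ ↦ ENNReal.ofReal (Real.exp (φ n))) (N ω) ∂P := by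
        refine lintegral_mono_ae ?_
        have hne : ∀ᵐ ω ∂P, N ω ≠ ⊤ := by rw [ae_iff]; simpa using htop
        filter_upwards [hne] with ω hω
        obtain ⟨n, hn⟩ := ENat.ne_top_iff_exists.1 hω
        rw [← hn]
        refine (hG n).trans (le_trans ?_ (ENNReal.le_tsum n))
        simp
    _ = ∑' n : ℕ, ∫⁻ ω, (Set.Ici (n : ℕ∞)).indicator
          (fun _ ↦ ENNReal.ofReal (Real.exp (φ n))) (N ω) ∂P :=
        lintegral_tsum fun n ↦ (Measurable.of_discrete (f := (Set.Ici (n : ℕ∞)).indicator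
          fun _ ↦ ENNReal.ofReal (Real.exp (φ n)))).comp_aemeasurable hN
    _ ≤ ∑' n : ℕ, ENNReal.ofReal (|C| * Real.exp (-n)) := by
        refine ENNReal.tsum_le_tsum fun n ↦ le_trans ?_ (htail' n)
        exact lintegral_indicator_const_le {ω | (n : ℕ∞) ≤ N ω} _
    _ < ∞ := hexp.tsum_ofReal_lt_top

end Moments

/-! ### Tails of the fluctuation number and the theorem. -/

namespace IsFractionalBrownianMotion

variable {Ω : Type*} [MeasurableSpace Ω] {P : Measure Ω} {H : ℝ} {B : ℝ≥0 → Ω → ℝ} {δ : ℝ}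

lemma aemeasurable_fluctuationNumber (hB : IsFractionalBrownianMotion H B P) (δ : ℝ) (T : ℝ≥0) :
    AEMeasurable (fun ω ↦ fluctuationNumber δ T fun t ↦ B t ω) P := by
  obtain ⟨X, hX, hXc, hBX⟩ := exists_measurable_continuous_modification
    hB.isGaussianProcess.aemeasurable hB.continuous_paths
  refine ⟨_, measurable_fluctuationNumber hX hXc δ T, ?_⟩
  filter_upwards [hBX] with ω hω
  simp only [hω]

variable [IsProbabilityMeasure P]

lemma exists_gaussian_tail (hB : IsFractionalBrownianMotion H B P) (hH : 1 / 2 ≤ H) (hδ : 0 < δ)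
    (T : ℝ≥0) : ∃ c C : ℝ, 0 < c ∧ ∀ n : ℕ,
      P {ω | (n : ℕ∞) ≤ fluctuationNumber δ T fun t ↦ B t ω}
        ≤ ENNReal.ofReal (C * Real.exp (-(c * n ^ 2))) := by
  obtain ⟨η, hη, hosc⟩ := exists_half_le_measure_smallOscillation hB.continuous_paths
    (div_pos hδ four_pos) (T + 1)
  set L := ⌈(T + 1) / η⌉₊
  set σ : ℝ := ((T : ℝ) + 1) ^ H with hσ
  have hσ0 : 0 < σ := by positivity
  set c : ℝ := 2 * (δ / 4) ^ 2 / (Real.pi ^ 2 * σ ^ 2) with hc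
  have hpi := Real.pi_pos
  have hc0 : 0 < c := by positivity
  -- For `n = m + L`, the inequality `n² ≤ 2 m² + 2 L²` costs half the rate and the factor `exp (c
  -- L²)`. That factor also makes the bound trivial for `n ≤ L`.
  refine ⟨c / 2, 2 * Real.exp (c * L ^ 2), by positivity, fun n ↦ ?_⟩
  rw [mul_assoc, ← Real.exp_add]
  rcases le_total L n with h | h
  · obtain ⟨m, rfl⟩ := Nat.exists_eq_add_of_le' h
    refine (hB.measure_le_fluctuationNumber_le hδ hη (hosc η le_rfl) hσ0 ?_).trans ?_
    · intro n s a hs hsT ha _ _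
      refine (hB.variance_sum_mul_sub_le_of_half_le hH hs ha).trans ?_
      rw [hσ, ← Real.rpow_natCast, ← Real.rpow_mul (by positivity), mul_comm H]
      have h0 : (s 0 : ℝ) ≤ s (Fin.last n) := hs (Fin.zero_le _)
      have h1 : (s (Fin.last n) : ℝ) ≤ T + 1 := hsT _
      have h2 : (0 : ℝ) ≤ s 0 := (s 0).coe_nonneg
      exact Real.rpow_le_rpow (by linarith) (by linarith) (by linarith)
    · refine ENNReal.ofReal_le_ofReal ?_
      gcongr
      have : 2 * (m * (δ / 4)) ^ 2 / (Real.pi ^ 2 * σ ^ 2) = c * m ^ 2 := by rw [hc]; ring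
      rw [this]
      push_cast
      nlinarith [mul_nonneg hc0.le (sq_nonneg ((m : ℝ) - L))]
  · refine prob_le_one.trans ?_
    rw [← ENNReal.ofReal_one]
    refine ENNReal.ofReal_le_ofReal ?_
    have hnL : (n : ℝ) ≤ L := by exact_mod_cast h
    have : (n : ℝ) ^ 2 ≤ (L : ℝ) ^ 2 := by gcongr
    have := Real.one_le_exp (x := c * L ^ 2 + -(c / 2 * n ^ 2)) (by nlinarith [sq_nonneg (L : ℝ)])
    linarith

lemma exists_exponential_tail_of_le_half (hB : IsFractionalBrownianMotion H B P) (hH0 : 0 < H)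
    (hH : H ≤ 1 / 2) (hδ : 0 < δ) (T : ℝ≥0) {c : ℝ} (hc : 0 < c) : ∃ C : ℝ, ∀ n : ℕ,
      P {ω | (n : ℕ∞) ≤ fluctuationNumber δ T fun t ↦ B t ω}
        ≤ ENNReal.ofReal (C * Real.exp (-(c * n))) := by
  obtain ⟨η₀, hη₀, hosc⟩ := exists_half_le_measure_smallOscillation hB.continuous_paths
    (div_pos hδ four_pos) (T + 1)
  have hpi := Real.pi_pos
  -- With `σ² = 2 m η ^ (2H)` the exponent is `m (δ / 4)² / (π² η ^ (2H))`, which is at least `c m`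
  -- for this choice of `η`.
  obtain ⟨η, hη, hηη₀, hηc⟩ : ∃ η : ℝ≥0, 0 < η ∧ η ≤ η₀ ∧
      (η : ℝ) ^ (2 * H) ≤ (δ / 4) ^ 2 / (Real.pi ^ 2 * c) := by
    set y : ℝ≥0 := ⟨(δ / 4) ^ 2 / (Real.pi ^ 2 * c), by positivity⟩
    have hy : 0 < y := NNReal.coe_pos.1 (by positivity : 0 < (δ / 4) ^ 2 / (Real.pi ^ 2 * c))
    refine ⟨min η₀ (y ^ (2 * H)⁻¹), lt_min hη₀ (NNReal.rpow_pos hy), min_le_left _ _, ?_⟩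
    have : min η₀ (y ^ (2 * H)⁻¹) ^ (2 * H) ≤ y := by
      calc _ ≤ (y ^ (2 * H)⁻¹) ^ (2 * H) := NNReal.rpow_le_rpow (min_le_right _ _) (by positivity)
        _ = y := NNReal.rpow_inv_rpow (by positivity) _
    exact_mod_cast this
  set L := ⌈(T + 1) / η⌉₊
  refine ⟨2 * Real.exp (c * L), fun n ↦ ?_⟩
  rw [mul_assoc, ← Real.exp_add]
  -- The strict inequality gives `m > 0`, hence `σ > 0`.
  rcases lt_or_ge L n with h | h
  · obtain ⟨m, rfl⟩ := Nat.exists_eq_add_of_le' h.le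
    have hm : (0 : ℝ) < m := by exact_mod_cast (by omega : 0 < m)
    have hη' : (0 : ℝ) < (η : ℝ) ^ (2 * H) := Real.rpow_pos_of_pos (by exact_mod_cast hη) _
    refine (hB.measure_le_fluctuationNumber_le hδ hη (hosc η hηη₀)
      (σ := √(2 * (m * (η : ℝ) ^ (2 * H)))) (by positivity) ?_).trans ?_
    · intro n s a hs hsT _ ha hsum
      refine (hB.variance_sum_mul_sub_le_of_le_half hH0 hH hs).trans ?_
      rw [Real.sq_sqrt (by positivity), ← hsum, Finset.sum_mul]
      gcongr 2 * ?_
      refine Finset.sum_le_sum fun i _ ↦ ?_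
      rcases eq_or_ne (a i) 0 with h | h
      · simp [h]
      · have h1 : (s i.succ : ℝ) ≤ s i.castSucc + η := ha i h
        have h2 : (s i.castSucc : ℝ) ≤ s i.succ := hs i.castSucc_le_succ
        refine mul_le_mul_of_nonneg_left ?_ (sq_nonneg _)
        exact Real.rpow_le_rpow (by linarith) (by linarith) (by positivity)
    · refine ENNReal.ofReal_le_ofReal ?_
      gcongr
      rw [Real.sq_sqrt (by positivity)]
      have h1 : c * m ≤ 2 * (m * (δ / 4)) ^ 2 /
          (Real.pi ^ 2 * (2 * (m * (η : ℝ) ^ (2 * H)))) := by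
        rw [le_div_iff₀ (by positivity)]
        rw [le_div_iff₀ (by positivity)] at hηc
        nlinarith [mul_le_mul_of_nonneg_left hηc (sq_nonneg (m : ℝ))]
      push_cast
      linarith
  · refine prob_le_one.trans ?_
    rw [← ENNReal.ofReal_one]
    refine ENNReal.ofReal_le_ofReal ?_
    have hnL : (n : ℝ) ≤ L := by exact_mod_cast h
    have := Real.one_le_exp (x := c * L + -(c * n)) (by nlinarith)
    linarith

lemma exists_exponential_tail (hB : IsFractionalBrownianMotion H B P) (hH0 : 0 < H)
    (hδ : 0 < δ) (T : ℝ≥0) {c : ℝ} (hc : 0 < c) : ∃ C : ℝ, ∀ n : ℕ,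
      P {ω | (n : ℕ∞) ≤ fluctuationNumber δ T fun t ↦ B t ω}
        ≤ ENNReal.ofReal (C * Real.exp (-(c * n))) := by
  rcases le_total H (1 / 2) with hH | hH
  · exact hB.exists_exponential_tail_of_le_half hH0 hH hδ T hc
  · obtain ⟨b, C, hb, h⟩ := hB.exists_gaussian_tail hH hδ T
    -- A Gaussian tail beats every exponential: `c n ≤ b n² + c² / (4b)`.
    refine ⟨|C| * Real.exp (c ^ 2 / (4 * b)), fun n ↦ (h n).trans (ENNReal.ofReal_le_ofReal ?_)⟩
    rw [mul_assoc, ← Real.exp_add]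
    gcongr
    · exact le_abs_self C
    · have : c ^ 2 / (4 * b) + -(c * n) + b * n ^ 2 = (2 * b * n - c) ^ 2 / (4 * b) := by
        field_simp
        ring
      have : 0 ≤ (2 * b * n - c) ^ 2 / (4 * b) := by positivity
      linarith

end IsFractionalBrownianMotion

theorem mainTheorem6 {Ω : Type*} [MeasurableSpace Ω] (P : Measure Ω) [IsProbabilityMeasure P]
    (H : ℝ) (hH0 : 0 < H) (hH1 : H ≤ 1)
    (B : ℝ≥0 → Ω → ℝ) (hB : IsFractionalBrownianMotion H B P)
    (δ : ℝ) (hδ : 0 < δ) (T : ℝ≥0) (hT : 0 < T) :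
    AEMeasurable (fun ω ↦ fluctuationNumber δ T (fun t ↦ B t ω)) P ∧
    (∀ a : ℝ,
      ∫⁻ ω, EReal.exp ((a : EReal) *
        ((fluctuationNumber δ T (fun t ↦ B t ω) : ℝ≥0∞) : EReal)) ∂P < ∞) ∧
    (1 / 2 ≤ H →
      ∃ a : ℝ, 0 < a ∧
        ∫⁻ ω, EReal.exp ((a : EReal) *
          ((fluctuationNumber δ T (fun t ↦ B t ω) : ℝ≥0∞) : EReal) ^ 2) ∂P < ∞) := by
  have hmeas := hB.aemeasurable_fluctuationNumber δ T
  have hcoe (n : ℕ) : (((n : ℕ∞) : ℝ≥0∞) : EReal) = ((n : ℝ) : EReal) := by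
    rw [ENat.toENNReal_coe, EReal.coe_natCast]
    rfl
  refine ⟨hmeas, fun a ↦ ?_, fun hH ↦ ?_⟩
  -- The extra `1` in the rate supplies the summable factor `exp (-n)`.
  · obtain ⟨C, hC⟩ := hB.exists_exponential_tail hH0 hδ T (c := |a| + 1) (by positivity)
    refine lintegral_comp_lt_top_of_tail_le hmeas (φ := fun n ↦ |a| * n) (fun n ↦ by positivity)
      (C := C) (fun n ↦ ?_) (G := fun N ↦ EReal.exp ((a : EReal) * ((N : ℝ≥0∞) : EReal)))
      fun n ↦ ?_
    · convert hC n using 4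
      ring
    · simp only [hcoe]
      rw [← EReal.coe_mul, EReal.exp_coe]
      gcongr
      exact le_abs_self a
  · obtain ⟨c, C, hc, h⟩ := hB.exists_gaussian_tail hH hδ T
    -- Half the rate goes to the moment; the other half pays for `exp (-n)`, since `n ≤ c n² / 2 + 1
    -- / (2c)`.
    refine ⟨c / 2, half_pos hc, ?_⟩
    refine lintegral_comp_lt_top_of_tail_le hmeas (φ := fun n ↦ c / 2 * n ^ 2)
      (fun n ↦ by positivity) (C := |C| * Real.exp (1 / (2 * c))) (fun n ↦ ?_)
      (G := fun N ↦ EReal.exp (((c / 2 : ℝ) : EReal) * ((N : ℝ≥0∞) : EReal) ^ 2)) fun n ↦ ?_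
    · refine (h n).trans (ENNReal.ofReal_le_ofReal ?_)
      rw [mul_assoc, ← Real.exp_add]
      gcongr
      · exact le_abs_self C
      · have : 1 / (2 * c) + (-(c / 2 * n ^ 2) - n) + c * n ^ 2 = (c * n - 1) ^ 2 / (2 * c) := by
          field_simp
          ring
        have : 0 ≤ (c * n - 1) ^ 2 / (2 * c) := by positivity
        linarith
    · simp only [hcoe]
      rw [← EReal.coe_pow, ← EReal.coe_mul, EReal.exp_coe]
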